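/- Let $\mathcal G$ be a weighted digraph on nodes $v_1,\dots,v_n$ with nonnegative adjacency matrix $A=[a_{ij}]$, $a_{ii}=0$, where $a_{ij}>0$ if and only if there is an edge from $v_j$ to $v_i$. Assume that $\mathcal G$ is a directed ring: every node has exactly one outgoing edge and exactly one incoming edge. Let $e_i$ be the edge towards $v_i$, with weight $a_i>0$ ($a_i=a_{ij}$ if $e_i=(v_j,v_i)$), and let $B\in\mathbb R^{n\times n}$ be the incidence matrix, whose $(k,i)$ entry is $-1$ if $e_i$ is towards $v_k$, $1$ if $e_i$ originates from $v_k$, and $0$ otherwise. Let $g_1,\dots,g_n:\mathbb R\to\mathbb R$ be nondecreasing (not necessarily continuous) functions with $\lim_{y\to\infty}|g_i(y)|=\infty$, and put $g(y)=(a_1g_1(y_1),\dots,a_ng_n(y_n))$. For a map $X$ between Euclidean spaces let $$\mathcal F[X](x)=\bigcap_{\delta>0}\ \bigcap_{\mu(S)=0}\overline{\mathrm{co}}\,X(B(x,\delta)\setminus S)$$ be its Filippov set-valued map, where $\mu$ is the Lebesgue measure and, in this formula only, $B(x,\delta)$ is the open ball. Suppose that either 1. $n=2$ and $g_1,g_2$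 are odd, or 2. $n\ge 3$, $g_i(0)=0$ for all $i$, and $\mathcal F[g_i](0)=\{0\}$ for at least one $i$. Then every Filippov solution $x:[0,\infty)\to\mathbb R^n$ of $\dot x=g(B^\top x)$, that is, every locally absolutely continuous $x$ with $\dot x(t)\in\mathcal F[\,y\mapsto g(B^\top y)\,](x(t))$ for almost every $t>0$, converges to the set $$\mathcal H_2=\Big\{x\in\mathbb R^n:\ 0\in\prod_{i=1}^n\mathcal F[g_i](B_{\cdot,i}^\top x)\Big\},$$ in the sense that the Euclidean distance from $x(t)$ to $\mathcal H_2$ tends to $0$ as $t\to\infty$. -/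

import Mathlib

open MeasureTheory Set Filter Topology

noncomputable section

/-- The Filippov set-valued map `F[X](x) = ⋂_{δ>0} ⋂_{μ(S)=0} co̅ X(B(x,δ) ∖ S)`, with `μ` the
Lebesgue measure. -/
def filippovMap {E F : Type*} [NormedAddCommGroup E] [MeasureSpace E]
    [NormedAddCommGroup F] [NormedSpace ℝ F] (X : E → F) (x : E) : Set F :=
  ⋂ (δ : ℝ) (_ : 0 < δ) (S : Set E) (_ : volume S = 0),
    closure (convexHull ℝ (X '' (Metric.ball x δ \ S)))

/-- `x` is a Filippov solution of `ẋ = X(x)` on `[0, ∞)`: it is absolutely continuous on every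
interval `[0, T]`, and for almost every `t > 0` it is differentiable at `t` with
`ẋ(t) ∈ F[X](x(t))`. -/
def IsFilippovSolution {n : ℕ} (X : EuclideanSpace ℝ (Fin n) → EuclideanSpace ℝ (Fin n))
    (x : ℝ → EuclideanSpace ℝ (Fin n)) : Prop :=
  (∀ T : ℝ, 0 < T → AbsolutelyContinuousOnInterval x 0 T) ∧
    ∀ᵐ t ∂(volume.restrict (Ioi (0 : ℝ))), ∃ v ∈ filippovMap X (x t), HasDerivAt x v t

/-- A weighted digraph on `n` nodes, given by its nonnegative adjacency matrix `A = [a_ij]` with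
zero diagonal. -/
structure WeightedDigraph (n : ℕ) where
  /-- the weighted adjacency matrix -/
  A : Matrix (Fin n) (Fin n) ℝ
  nonneg : ∀ i j, 0 ≤ A i j
  diag : ∀ i, A i i = 0

namespace WeightedDigraph

/-- There is an edge from `v_i` to `v_j`, i.e. `a_ji > 0`. -/
def Edge {n : ℕ} (G : WeightedDigraph n) (i j : Fin n) : Prop := 0 < G.A j i

/-- Every node has exactly one outgoing edge and exactly one incoming edge. -/
def IsDirectedRing {n : ℕ} (G : WeightedDigraph n) : Prop :=
  (∀ i, ∃! j, G.Edge i j) ∧ ∀ i, ∃! k, G.Edge k i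

/-- `e` lists the edges of a directed ring, as pairs (tail, head), in the order in which the
vectorized system `ẋ = g(Bᵀx)` uses them: the `i`-th edge is the edge towards node `v_i`. -/
def IsRingLabelling {n : ℕ} (G : WeightedDigraph n) (e : Fin n → Fin n × Fin n) : Prop :=
  ∀ i, (e i).2 = i ∧ G.Edge (e i).1 (e i).2

/-- The weight of an edge `(v_i, v_j)`, namely `a_ji`. -/
def weight {n : ℕ} (G : WeightedDigraph n) (e : Fin n × Fin n) : ℝ := G.A e.2 e.1

/-- The right-hand side of the protocol `ẋ_i = -∑_j a_ij g_ij(x_i - x_j)`. -/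
def communicationProtocol {n : ℕ} (G : WeightedDigraph n) (g : Fin n → Fin n → ℝ → ℝ)
    (x : EuclideanSpace ℝ (Fin n)) : EuclideanSpace ℝ (Fin n) :=
  WithLp.toLp 2 fun i => -∑ j, G.A i j * g i j (x i - x j)

end WeightedDigraph

/-- The incidence matrix of a list of edges (tail, head): its `(i, j)` entry is `-1` if the `j`-th
edge is towards `v_i`, `1` if the `j`-th edge originates from `v_i`, and `0` otherwise. -/
def incidence {n m : ℕ} (e : Fin m → Fin n × Fin n) : Matrix (Fin n) (Fin m) ℝ :=
  Matrix.of fun i j => if (e j).2 = i then -1 else if (e j).1 = i then 1 else 0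

/-- The number `B_{·,i}ᵀ x`, the `i`-th entry of `Bᵀ x`, with `B` the incidence matrix. -/
def edgeDiff {n m : ℕ} (e : Fin m → Fin n × Fin n) (x : EuclideanSpace ℝ (Fin n)) (i : Fin m) : ℝ :=
  ((incidence e).transpose.mulVec x.ofLp) i

/-- The vector field `x ↦ g(Bᵀ x)`, where `g(y) = [a_1 g_1(y_1), …, a_n g_n(y_n)]`. -/
def ringField {n : ℕ} (G : WeightedDigraph n) (e : Fin n → Fin n × Fin n) (g : Fin n → ℝ → ℝ)
    (x : EuclideanSpace ℝ (Fin n)) : EuclideanSpace ℝ (Fin n) :=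
  WithLp.toLp 2 fun i => G.weight (e i) * g i (edgeDiff e x i)

/-- The set `H₂ = {x : 0_n ∈ ∏_i F[g_i](B_{·,i}ᵀ x)}`. -/
def ringLimitSet {n : ℕ} (e : Fin n → Fin n × Fin n) (g : Fin n → ℝ → ℝ) :
    Set (EuclideanSpace ℝ (Fin n)) :=
  {x | (0 : Fin n → ℝ) ∈ Set.univ.pi fun i => filippovMap (g i) (edgeDiff e x i)}

/-- The increasing functions with `|f(y)| → ∞` as `y → ∞`; no continuity is assumed. -/
def IsAdmissible (f : ℝ → ℝ) : Prop :=
  Monotone f ∧ Tendsto (fun y => |f y|) atTop atTop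

/-- Along an edge `(v_j, v_i)` with `j ≠ i`, the entry of `Bᵀ x` is `x_j - x_i`. -/
theorem edgeDiff_eq {n m : ℕ} (e : Fin m → Fin n × Fin n) (x : EuclideanSpace ℝ (Fin n))
    (i : Fin m) (h : (e i).1 ≠ (e i).2) : edgeDiff e x i = x (e i).1 - x (e i).2 := by
  have key : ∀ k, (if (e i).2 = k then (-1 : ℝ) else if (e i).1 = k then 1 else 0) * x k =
      (if (e i).1 = k then x k else 0) - (if (e i).2 = k then x k else 0) := by
    intro k
    by_cases h2 : (e i).2 = k
    · have h1 : (e i).1 ≠ k := fun h1 => h (h1.trans h2.symm)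
      simp [h1, h2]
    · by_cases h1 : (e i).1 = k <;> simp [h1, h2]
  simp only [edgeDiff, incidence, Matrix.mulVec, dotProduct, Matrix.transpose_apply,
    Matrix.of_apply]
  rw [Finset.sum_congr rfl fun k _ => key k, Finset.sum_sub_distrib]
  simp

/-- On a directed ring, `ẋ = g(Bᵀ x)` is the protocol `ẋ_i = -∑_j a_ij g_ij(x_i - x_j)`, where the
edge `e_i = (v_j, v_i)` carries `g_ij(y) = -g_i(-y)`. -/
theorem ringField_eq_communicationProtocol {n : ℕ} (G : WeightedDigraph n)
    (hG : G.IsDirectedRing) (e : Fin n → Fin n × Fin n) (he : G.IsRingLabelling e)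
    (g : Fin n → ℝ → ℝ) :
    ringField G e g = G.communicationProtocol fun i _ y => -g i (-y) := by
  funext x
  unfold ringField WeightedDigraph.communicationProtocol
  congr 1
  funext i
  obtain ⟨h2, hE⟩ := he i
  rw [h2] at hE
  have hne : (e i).1 ≠ i := by
    intro h
    rw [h] at hE
    simp [WeightedDigraph.Edge, G.diag] at hE
  rw [Finset.sum_eq_single (e i).1]
  · rw [edgeDiff_eq e x i (by rw [h2]; exact hne), h2]
    simp [WeightedDigraph.weight, h2]
  · intro j _ hj
    have hz : ¬ G.Edge j i := fun hji => hj ((hG.2 i).unique hji hE)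
    have : G.A i j = 0 := le_antisymm (not_lt.mp hz) (G.nonneg i j)
    simp [this]
  · simp

end

/-! On a ring each node sees only its predecessor. A coordinate `z` with predecessor `u` therefore
solves a scalar inclusion: its velocity lies between the one-sided limits at `u - z` of a
nondecreasing `f` with `f 0 = 0` (`Follows`). It suffices that every difference `u - z` converges to
a point where `f` changes sign: such a point is a Filippov zero, and the limit set is the preimage
under `Bᵀ` of the set of these zeros (`tendsto_infDist_preimage`).

Nodes that once agree do so forever. Otherwise the largest value decreases to a limit `M` and the
smallest one increases to a limit; suppose that these differ. If every `f` is negative on the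
negative numbers, a node lagging behind `M` pulls the whole cycle below `M` within a fixed time,
which is impossible (`eventually_sub_lt`). If instead some `f` is nonnegative at a negative point,
its node either converges or ends up separated from the limit of the smallest value; without a
convergent node this separation would spread around the cycle, which is again impossible
(`exists_tendsto_of_nonpos`, for the negated system). One convergent node makes its successor
converge, hence all of them (`Follows.exists_tendsto`), and the limits are equilibria because
otherwise some velocity would stay away from zero. -/

/-! ### Absolutely continuous functions -/

/-- Absolute continuity on every interval `[0, T]`. -/
def LocallyAbsolutelyContinuous {E : Type*} [PseudoMetricSpace E] (f : ℝ → E) : Prop :=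
  ∀ T : ℝ, 0 < T → AbsolutelyContinuousOnInterval f 0 T

/-- `z` solves the scalar differential inclusion `ż ∈ [f(y-), f(y+)]` with `y = u - z`, almost
everywhere on `(0, ∞)`. -/
def Follows (f u z : ℝ → ℝ) : Prop :=
  ∀ᵐ t, 0 < t → ∃ v, HasDerivAt z v t ∧
    (∀ y, y < u t - z t → f y ≤ v) ∧ ∀ y, u t - z t < y → v ≤ f y

theorem LocallyAbsolutelyContinuous.on {E : Type*} [PseudoMetricSpace E] {f : ℝ → E}
    (hf : LocallyAbsolutelyContinuous f) {a b : ℝ} (ha : 0 ≤ a) (hab : a ≤ b) :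
    AbsolutelyContinuousOnInterval f a b := by
  refine (hf (b + 1) (by linarith)).mono ?_
  rw [uIcc_of_le hab, uIcc_of_le (by linarith)]
  exact Icc_subset_Icc ha (by linarith)

theorem LocallyAbsolutelyContinuous.continuousOn {f : ℝ → ℝ}
    (hf : LocallyAbsolutelyContinuous f) {a b : ℝ} (ha : 0 ≤ a) :
    ContinuousOn f (Icc a b) := by
  rcases le_or_gt a b with hab | hab
  · have h := hf.on ha hab
    rw [← uIcc_of_le hab]
    exact h.continuousOn
  · rw [Icc_eq_empty_of_lt hab]
    exact continuousOn_empty f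

theorem LocallyAbsolutelyContinuous.neg {f : ℝ → ℝ} (hf : LocallyAbsolutelyContinuous f) :
    LocallyAbsolutelyContinuous (fun t => -f t) :=
  fun T hT => (hf T hT).neg

/-- The image of an absolutely continuous function under a Lipschitz map, or more generally any
function whose increments are dominated by finitely many absolutely continuous ones, is
absolutely continuous. -/
theorem LocallyAbsolutelyContinuous.of_dist_le_sum {ι E F : Type*} [Fintype ι]
    [PseudoMetricSpace E] [PseudoMetricSpace F] {X : ι → ℝ → E} {f : ℝ → F}
    (hX : ∀ i, LocallyAbsolutelyContinuous (X i))
    (h : ∀ s t, dist (f s) (f t) ≤ ∑ i, dist (X i s) (X i t)) :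
    LocallyAbsolutelyContinuous f := by
  intro T hT
  have hsum := tendsto_finsetSum Finset.univ fun i _ => hX i T hT
  rw [Finset.sum_const_zero] at hsum
  refine squeeze_zero (fun E => Finset.sum_nonneg fun _ _ => dist_nonneg) (fun E => ?_) hsum
  rw [Finset.sum_comm]
  exact Finset.sum_le_sum fun i _ => h _ _

theorem LocallyAbsolutelyContinuous.le_of_deriv_le {f : ℝ → ℝ}
    (hf : LocallyAbsolutelyContinuous f) {a b c : ℝ} (ha : 0 ≤ a) (hab : a ≤ b)
    (h : ∀ᵐ t, a < t → t < b → ∃ v, HasDerivAt f v t ∧ v ≤ c) :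
    f b ≤ f a + c * (b - a) := by
  have hac := hf.on ha hab
  have hint : ∫ t in a..b, deriv f t ≤ ∫ _ in a..b, c := by
    refine intervalIntegral.integral_mono_ae_restrict hab hac.intervalIntegrable_deriv
      intervalIntegrable_const ?_
    rw [EventuallyLE, ae_restrict_iff' measurableSet_Icc]
    filter_upwards [h, Measure.ae_ne volume a, Measure.ae_ne volume b] with t ht hta htb hmem
    obtain ⟨v, hv, hvc⟩ := ht (lt_of_le_of_ne hmem.1 (Ne.symm hta)) (lt_of_le_of_ne hmem.2 htb)
    rw [hv.deriv]
    exact hvc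
  rw [hac.integral_deriv_eq_sub, intervalIntegral.integral_const, smul_eq_mul] at hint
  linarith

/-- A continuous function that exceeds `r` at `b` but not at `a` has a last time at which it is
equal to `r`. -/
theorem exists_last_le {f : ℝ → ℝ} {a b r : ℝ} (hf : ContinuousOn f (Icc a b)) (hab : a ≤ b)
    (hfa : f a ≤ r) (hfb : r < f b) :
    ∃ s ∈ Ico a b, f s ≤ r ∧ ∀ t ∈ Ioc s b, r < f t := by
  have hcl : IsClosed (Icc a b ∩ f ⁻¹' Iic r) := hf.preimage_isClosed_of_isClosed isClosed_Icc
    isClosed_Iic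
  have hcomp : IsCompact (Icc a b ∩ f ⁻¹' Iic r) :=
    isCompact_Icc.of_isClosed_subset hcl inter_subset_left
  obtain ⟨s, ⟨hs, hsr⟩, hmax⟩ := hcomp.exists_isGreatest ⟨a, ⟨le_rfl, hab⟩, hfa⟩
  refine ⟨s, ⟨hs.1, lt_of_le_of_ne hs.2 ?_⟩, hsr, fun t ht => ?_⟩
  · rintro rfl
    exact absurd hsr (not_le.mpr hfb)
  · by_contra hcon
    exact absurd (hmax ⟨⟨hs.1.trans ht.1.le, ht.2⟩, not_lt.mp hcon⟩) (not_le.mpr ht.1)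

theorem LocallyAbsolutelyContinuous.le_of_deriv_nonpos_above {f : ℝ → ℝ}
    (hf : LocallyAbsolutelyContinuous f) {a b r : ℝ} (ha : 0 ≤ a) (hab : a ≤ b)
    (h : ∀ᵐ t, a < t → t < b → r < f t → ∃ v, HasDerivAt f v t ∧ v ≤ 0) (hfa : f a ≤ r) :
    f b ≤ r := by
  by_contra! hfb
  obtain ⟨s, hs, hsr, hst⟩ := exists_last_le (hf.continuousOn ha) hab hfa hfb
  have := hf.le_of_deriv_le (c := 0) (ha.trans hs.1) hs.2.le (by
    filter_upwards [h] with t ht h1 h2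
    exact ht (hs.1.trans_lt h1) h2 (hst t ⟨h1, h2.le⟩))
  linarith

/-! ### The scalar inclusion of one follower -/

theorem Follows.neg {f u z : ℝ → ℝ} (h : Follows f u z) :
    Follows (fun y => -f (-y)) (fun t => -u t) (fun t => -z t) := by
  filter_upwards [h] with t ht h0
  obtain ⟨v, hv, h1, h2⟩ := ht h0
  refine ⟨-v, hv.neg, fun y hy => ?_, fun y hy => ?_⟩
  · exact neg_le_neg (h2 (-y) (by linarith))
  · exact neg_le_neg (h1 (-y) (by linarith))

/-- A follower that eventually decreases above the level `r` ends up on one side of `r`. -/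
theorem Follows.eventually_le_or_lt {f u z : ℝ → ℝ} (hz : LocallyAbsolutelyContinuous z)
    (h : Follows f u z) {r y : ℝ} (hy : f y ≤ 0)
    (hev : ∀ᶠ t in atTop, r < z t → u t - z t < y) :
    (∀ᶠ t in atTop, z t ≤ r) ∨ ∀ᶠ t in atTop, r < z t := by
  obtain ⟨T, hT⟩ := eventually_atTop.mp (hev.and (eventually_ge_atTop 0))
  by_cases hex : ∃ a ≥ T, z a ≤ r
  · obtain ⟨a, haT, hza⟩ := hex
    refine .inl (eventually_atTop.mpr ⟨a, fun b hb => ?_⟩)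
    refine hz.le_of_deriv_nonpos_above (hT a haT).2 hb ?_ hza
    filter_upwards [h] with t ht h1 _ hr
    obtain ⟨v, hv, -, h2⟩ := ht ((hT a haT).2.trans_lt h1)
    exact ⟨v, hv, (h2 y ((hT t (haT.trans h1.le)).1 hr)).trans hy⟩
  · push Not at hex
    exact .inr (eventually_atTop.mpr ⟨T, hex⟩)

theorem Follows.eventually_ge_or_gt {f u z : ℝ → ℝ} (hz : LocallyAbsolutelyContinuous z)
    (h : Follows f u z) {r y : ℝ} (hy : 0 ≤ f y)
    (hev : ∀ᶠ t in atTop, z t < r → y < u t - z t) :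
    (∀ᶠ t in atTop, r ≤ z t) ∨ ∀ᶠ t in atTop, z t < r := by
  have := h.neg.eventually_le_or_lt hz.neg (r := -r) (y := -y) (by simpa using hy) (by
    filter_upwards [hev] with t ht hr
    linarith [ht (by linarith)])
  simpa using this

theorem Follows.nonpos_of_tendsto {f u z : ℝ → ℝ} (hz : LocallyAbsolutelyContinuous z)
    (h : Follows f u z) {c l y : ℝ} (hu : Tendsto u atTop (𝓝 c)) (hl : Tendsto z atTop (𝓝 l))
    (hy : y < c - l) : f y ≤ 0 := by
  by_contra! hpos
  obtain ⟨T, hT⟩ := eventually_atTop.mp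
    (((hu.sub hl).eventually_const_lt hy).and (eventually_ge_atTop 0))
  have hlin : ∀ b ≥ T, z T + f y * (b - T) ≤ z b := by
    intro b hb
    have := hz.neg.le_of_deriv_le (c := -f y) (hT T le_rfl).2 hb (by
      filter_upwards [h] with t ht h1 _
      obtain ⟨v, hv, h2, -⟩ := ht ((hT T le_rfl).2.trans_lt h1)
      exact ⟨-v, hv.neg, neg_le_neg (h2 y (hT t h1.le).1)⟩)
    linarith
  have hinf : Tendsto (fun b => z T + f y * (b - T)) atTop atTop :=
    tendsto_atTop_add_const_left _ _
      ((tendsto_atTop_add_const_right _ (-T) tendsto_id).const_mul_atTop hpos)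
  exact not_tendsto_nhds_of_tendsto_atTop
    (tendsto_atTop_mono' _ (eventually_atTop.mpr ⟨T, hlin⟩) hinf) l hl

theorem Follows.nonneg_of_tendsto {f u z : ℝ → ℝ} (hz : LocallyAbsolutelyContinuous z)
    (h : Follows f u z) {c l y : ℝ} (hu : Tendsto u atTop (𝓝 c)) (hl : Tendsto z atTop (𝓝 l))
    (hy : c - l < y) : 0 ≤ f y := by
  simpa using h.neg.nonpos_of_tendsto hz.neg hu.neg hl.neg (y := -y) (by linarith)

/-- For any `a < b`, the sign of `f` at the limiting difference of a follower at the midpoint of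
`[a, b]` makes a level inside `(a, b)` crossable in one direction only, so `z` cannot oscillate
across `[a, b]`. -/
theorem Follows.exists_tendsto {f u z : ℝ → ℝ} (hz : LocallyAbsolutelyContinuous z)
    (h : Follows f u z) {c : ℝ} (hu : Tendsto u atTop (𝓝 c))
    (hle : IsBoundedUnder (· ≤ ·) atTop z) (hge : IsBoundedUnder (· ≥ ·) atTop z) :
    ∃ l, Tendsto z atTop (𝓝 l) := by
  refine tendsto_of_no_upcrossings dense_univ (fun a _ b _ hab hfr => ?_) hle hge
  rcases le_total (f (c - (a + b) / 2)) 0 with hf | hf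
  -- With `r = (a + 3b)/4`, the slack `(b - a)/4` in `u` is exactly what gives `u - z < c - (a +
  -- b)/2` above `r`.
  · have hev := hu.eventually_lt_const (show c < c + (b - a) / 4 by linarith)
    rcases h.eventually_le_or_lt hz (r := (a + 3 * b) / 4) hf
      (hev.mono fun t h1 h2 => by linarith) with h1 | h1
    · exact hfr.2 (h1.mono fun t ht => by simp only [not_lt]; linarith)
    · exact hfr.1 (h1.mono fun t ht => by simp only [not_lt]; linarith)
  · have hev := hu.eventually_const_lt (show c - (b - a) / 4 < c by linarith)
    rcases h.eventually_ge_or_gt hz (r := (3 * a + b) / 4) hf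
      (hev.mono fun t h1 h2 => by linarith) with h1 | h1
    · exact hfr.1 (h1.mono fun t ht => by simp only [not_lt]; linarith)
    · exact hfr.2 (h1.mono fun t ht => by simp only [not_lt]; linarith)

/-- A bounded follower that eventually decreases above every level `r > U` converges, unless it
is eventually below all these levels. -/
theorem Follows.exists_tendsto_or_eventually_le {f u z : ℝ → ℝ}
    (hz : LocallyAbsolutelyContinuous z) (h : Follows f u z) {U y : ℝ} (hy : f y ≤ 0)
    (hev : ∀ r > U, ∀ᶠ t in atTop, r < z t → u t - z t < y)
    (hle : IsBoundedUnder (· ≤ ·) atTop z) (hge : IsBoundedUnder (· ≥ ·) atTop z) :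
    (∃ l, Tendsto z atTop (𝓝 l)) ∨ ∀ r > U, ∀ᶠ t in atTop, z t ≤ r := by
  refine or_iff_not_imp_right.mpr fun hnot => ?_
  push Not at hnot
  obtain ⟨r₀, hr₀, hfr₀⟩ := hnot
  refine tendsto_of_no_upcrossings dense_univ (fun a _ b _ hab hfr => ?_) hle hge
  have h₀ : ∀ᶠ t in atTop, r₀ < z t :=
    (h.eventually_le_or_lt hz hy (hev r₀ hr₀)).resolve_left fun h1 =>
      hfr₀ (h1.mono fun t ht => by simpa using ht)
  -- Hence `a > U`, so `a` itself is a level that can be crossed only downwards.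
  have har : r₀ < a := by
    obtain ⟨t, h1, h2⟩ := (hfr.1.and_eventually h₀).exists
    exact h2.trans h1
  rcases h.eventually_le_or_lt hz hy (hev a (hr₀.trans har)) with h1 | h1
  · exact hfr.2 (h1.mono fun t ht => by simp only [not_lt]; linarith)
  · exact hfr.1 (h1.mono fun t ht => by simp only [not_lt]; linarith)

/-! ### Cycles of followers and their extreme values -/

/-- Every node `σ i` of a finite cycle follows its predecessor `i`; the last field says that all
nodes are reached from any one of them by iterating `σ`. -/
structure IsCycleSystem {ι : Type*} (σ : ι → ι) (f : ι → ℝ → ℝ) (X : ι → ℝ → ℝ) : Prop where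
  mono : ∀ i, Monotone (f i)
  zero : ∀ i, f i 0 = 0
  ac : ∀ i, LocallyAbsolutelyContinuous (X i)
  follows : ∀ i, Follows (f (σ i)) (X i) (X (σ i))
  cycle_induction : ∀ P : ι → Prop, (∃ i, P i) → (∀ i, P i → P (σ i)) → ∀ j, P j

/-- The largest value at time `t` of finitely many trajectories. -/
noncomputable def maxVal {ι : Type*} (X : ι → ℝ → ℝ) (t : ℝ) : ℝ := ⨆ j, X j t

section MaxVal

variable {ι : Type*} [Finite ι] (X : ι → ℝ → ℝ)

theorem le_maxVal (i : ι) (t : ℝ) : X i t ≤ maxVal X t :=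
  le_ciSup (Set.finite_range fun j => X j t).bddAbove i

theorem exists_eq_maxVal [Nonempty ι] (t : ℝ) : ∃ i, X i t = maxVal X t :=
  exists_eq_ciSup_of_finite

end MaxVal

theorem LocallyAbsolutelyContinuous.maxVal {ι : Type*} [Finite ι] [Nonempty ι] {X : ι → ℝ → ℝ}
    (hX : ∀ i, LocallyAbsolutelyContinuous (X i)) :
    LocallyAbsolutelyContinuous (maxVal X) := by
  have := Fintype.ofFinite ι
  have key : ∀ s t, _root_.maxVal X s - _root_.maxVal X t ≤ ∑ i, dist (X i s) (X i t) := by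
    intro s t
    obtain ⟨i, hi⟩ := exists_eq_maxVal X s
    calc _root_.maxVal X s - _root_.maxVal X t ≤ X i s - X i t := by
          linarith [le_maxVal X i t]
      _ ≤ dist (X i s) (X i t) := le_abs_self _
      _ ≤ ∑ i, dist (X i s) (X i t) :=
          Finset.single_le_sum (f := fun i => dist (X i s) (X i t))
            (fun _ _ => dist_nonneg) (Finset.mem_univ i)
  refine .of_dist_le_sum hX fun s t => ?_
  rw [Real.dist_eq, abs_le]
  have h1 := key s t
  have h2 := key t s
  simp only [dist_comm (X _ t)] at h2
  exact ⟨by linarith, h1⟩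

namespace IsCycleSystem

variable {ι : Type*} {σ : ι → ι} {f : ι → ℝ → ℝ} {X : ι → ℝ → ℝ}

theorem neg (h : IsCycleSystem σ f X) :
    IsCycleSystem σ (fun i y => -f i (-y)) (fun i t => -X i t) where
  mono i _ _ hab := neg_le_neg (h.mono i (neg_le_neg hab))
  zero i := by simp [h.zero]
  ac i := (h.ac i).neg
  follows i := (h.follows i).neg
  cycle_induction := h.cycle_induction

theorem surjective (h : IsCycleSystem σ f X) : Function.Surjective σ := by
  intro i
  exact h.cycle_induction (fun i => ∃ j, σ j = i) ⟨σ i, i, rfl⟩ (fun j _ => ⟨j, rfl⟩) i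

/-- Without consensus, some node at the maximum has a predecessor strictly below it, so its velocity
is at most `f 0 = 0`. At a consensus this fails: if `f` jumps at `0`, all nodes may rise together.
-/
theorem maxVal_le [Finite ι] [Nonempty ι] (h : IsCycleSystem σ f X) {a b : ℝ} (ha : 0 ≤ a)
    (hab : a ≤ b) (hne : ∀ t, a < t → t < b → ∃ i, X i t ≠ maxVal X t) :
    maxVal X b ≤ maxVal X a := by
  have hM := LocallyAbsolutelyContinuous.maxVal h.ac
  have := hM.le_of_deriv_le (c := 0) ha hab (by
    filter_upwards [(hM.on ha hab).ae_differentiableAt, ae_all_iff.mpr h.follows]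
      with t hd hF hat htb
    obtain ⟨i, hi, hsi⟩ : ∃ i, X i t ≠ maxVal X t ∧ X (σ i) t = maxVal X t := by
      by_contra! hcon
      obtain ⟨j, hj⟩ := exists_eq_maxVal X t
      exact h.cycle_induction (fun i => X i t ≠ maxVal X t) (hne t hat htb) hcon j hj
    obtain ⟨v, hv, -, hv2⟩ := hF i (ha.trans_lt hat)
    have hD := (hd (by rw [uIcc_of_le hab]; exact ⟨hat.le, htb.le⟩)).hasDerivAt
    -- The maximum touches `X (σ i)` from above at `t`, so the two derivatives agree.
    have hmin : IsLocalMin (fun s => maxVal X s - X (σ i) s) t :=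
      Eventually.of_forall fun s => by
        show maxVal X t - X (σ i) t ≤ maxVal X s - X (σ i) s
        linarith [le_maxVal X (σ i) s]
    have hzero := hmin.hasDerivAt_eq_zero (hD.sub hv)
    have hlt := lt_of_le_of_ne (le_maxVal X i t) hi
    have hv0 := hv2 0 (by linarith)
    rw [h.zero] at hv0
    exact ⟨_, hD, by linarith⟩)
  linarith

/-- Once all nodes agree, they agree forever. -/
theorem consensus_persists [Finite ι] [Nonempty ι] (h : IsCycleSystem σ f X) {a b : ℝ}
    (ha : 0 ≤ a) (hab : a ≤ b) (heq : ∀ i, X i a = maxVal X a) (i : ι) :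
    X i b = maxVal X b := by
  set N : ι → ℝ → ℝ := fun i t => -X i t with hN
  set W : ℝ → ℝ := fun t => maxVal X t + maxVal N t with hW
  have hXN : ∀ j t, -X j t ≤ maxVal N t := fun j t => le_maxVal N j t
  have hWpos : ∀ t, 0 < W t → (∃ i, X i t ≠ maxVal X t) ∧ ∃ i, N i t ≠ maxVal N t := by
    intro t ht
    constructor
    · by_contra! hcon
      obtain ⟨j, hj⟩ := exists_eq_maxVal N t
      have := hcon j
      simp only [hW, hN] at ht hj
      linarith
    · by_contra! hcon
      obtain ⟨j, hj⟩ := exists_eq_maxVal X t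
      have := hcon j
      simp only [hW, hN] at ht this
      linarith
  have hWa : W a ≤ 0 := by
    obtain ⟨j, hj⟩ := exists_eq_maxVal N a
    have := heq j
    simp only [hW, hN] at hj ⊢
    linarith
  have hWb : W b ≤ 0 := by
    by_contra! hpos
    have hcont : ContinuousOn W (Icc a b) :=
      ((LocallyAbsolutelyContinuous.maxVal h.ac).continuousOn ha).add
        ((LocallyAbsolutelyContinuous.maxVal h.neg.ac).continuousOn ha)
    -- After the last time `s` with zero spread there is no consensus, so neither extreme moves
    -- outwards and the spread cannot become positive.
    obtain ⟨s, hs, hsW, hst⟩ := exists_last_le hcont hab hWa hpos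
    have h1 := h.maxVal_le (ha.trans hs.1) hs.2.le fun t h1 h2 => (hWpos t (hst t ⟨h1, h2.le⟩)).1
    have h2 := h.neg.maxVal_le (ha.trans hs.1) hs.2.le
      fun t h1 h2 => (hWpos t (hst t ⟨h1, h2.le⟩)).2
    simp only [hW, hN] at hsW hpos h1 h2
    linarith
  have := hXN i b
  have := le_maxVal X i b
  simp only [hW] at hWb
  linarith

/-- If one node converges, then all do, and the limits form an equilibrium. -/
theorem exists_tendsto_sub (h : IsCycleSystem σ f X)
    (hle : ∀ i, IsBoundedUnder (· ≤ ·) atTop (X i)) (hge : ∀ i, IsBoundedUnder (· ≥ ·) atTop (X i))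
    (hex : ∃ i l, Tendsto (X i) atTop (𝓝 l)) (i : ι) :
    ∃ l, Tendsto (fun t => X i t - X (σ i) t) atTop (𝓝 l) ∧
      (∀ y < l, f (σ i) y ≤ 0) ∧ ∀ y > l, 0 ≤ f (σ i) y := by
  obtain ⟨c, hc⟩ := h.cycle_induction (fun i => ∃ l, Tendsto (X i) atTop (𝓝 l)) hex
    (fun i ⟨_, hc⟩ => (h.follows i).exists_tendsto (h.ac _) hc (hle _) (hge _)) i
  obtain ⟨l, hl⟩ := (h.follows i).exists_tendsto (h.ac _) hc (hle _) (hge _)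
  exact ⟨c - l, hc.sub hl, fun y hy => (h.follows i).nonpos_of_tendsto (h.ac _) hc hl hy,
    fun y hy => (h.follows i).nonneg_of_tendsto (h.ac _) hc hl hy⟩

/-- A node whose function vanishes to the right of `0` makes some node converge. -/
theorem exists_tendsto_of_nonpos [Finite ι] [Nonempty ι] (h : IsCycleSystem σ f X)
    (hge : ∀ i, IsBoundedUnder (· ≥ ·) atTop (X i)) {M : ℝ}
    (hM : Tendsto (maxVal X) atTop (𝓝 M)) (hM' : ∀ᶠ t in atTop, M ≤ maxVal X t)
    {i₀ : ι} {y₀ : ℝ} (hy₀ : 0 < y₀) (hf : f i₀ y₀ ≤ 0) :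
    ∃ i l, Tendsto (X i) atTop (𝓝 l) := by
  by_contra! hcon
  have hcon' : ∀ i, ¬ ∃ l, Tendsto (X i) atTop (𝓝 l) := fun i ⟨l, hl⟩ => hcon i l hl
  have hle : ∀ i, IsBoundedUnder (· ≤ ·) atTop (X i) := fun i =>
    hM.isBoundedUnder_le.mono_le (Eventually.of_forall fun t => le_maxVal X i t)
  -- The node `i₀` cannot rise while it is above `M - y₀` by any margin; not converging, it settles
  -- below. A successor then inherits the same `U`, since `f 0 = 0` stops it from rising above its
  -- predecessor.
  have hall := h.cycle_induction (fun i => ∃ U < M, ∀ r > U, ∀ᶠ t in atTop, X i t ≤ r) (by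
      obtain ⟨j, rfl⟩ := h.surjective i₀
      refine ⟨σ j, M - y₀, by linarith, ?_⟩
      refine ((h.follows j).exists_tendsto_or_eventually_le (h.ac _) hf (fun r hr => ?_)
        (hle _) (hge _)).resolve_left (hcon' _)
      filter_upwards [hM.eventually_lt_const (show M < r + y₀ by linarith)] with t ht hrt
      linarith [le_maxVal X j t]) (by
      rintro i ⟨U, hU, hev⟩
      refine ⟨U, hU, ?_⟩
      refine ((h.follows i).exists_tendsto_or_eventually_le (h.ac _) (h.zero _).le
        (fun r hr => ?_) (hle _) (hge _)).resolve_left (hcon' _)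
      filter_upwards [hev r hr] with t ht hrt
      linarith)
  choose U hU hev using hall
  have hlt : ∀ᶠ t in atTop, ∀ i, X i t ≤ (U i + M) / 2 :=
    eventually_all.mpr fun i => hev i _ (by linarith [hU i])
  obtain ⟨t, h1, h2⟩ := (hlt.and hM').exists
  obtain ⟨i, hi⟩ := exists_eq_maxVal X t
  linarith [h1 i, hU i]

end IsCycleSystem

/-! ### Functions that are negative on the negative numbers -/

namespace IsCycleSystem

variable {ι : Type*} {σ : ι → ι} {f : ι → ℝ → ℝ} {X : ι → ℝ → ℝ}

/-- Suppose that the node `i` stays at most `M - d` on a time interval before each time of a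
window, while all nodes are eventually below every level above `M`. If the function of `σ i` is
negative on the negative numbers, then `σ i` is pushed below some level `M - d'` too. -/
theorem le_sub_of_predecessor_le (h : IsCycleSystem σ f X) {i : ι}
    (hneg : ∀ y < 0, f (σ i) y < 0) {M d τ : ℝ} (hd : 0 < d) (hτ : 0 < τ)
    (hM : ∀ r > M, ∀ᶠ t in atTop, X (σ i) t ≤ r) :
    ∃ d' > 0, ∀ᶠ a in atTop, (∀ t ∈ Icc a (a + τ), X i t ≤ M - d) →
      X (σ i) (a + τ) ≤ M - d' := by
  set η := -f (σ i) (-(d / 2)) with hη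
  have hηpos : 0 < η := neg_pos.mpr (hneg _ (by linarith))
  have hητ : 0 < η * τ := mul_pos hηpos hτ
  -- Above `M - d/2` the node falls at rate at least `η`; starting no higher than `M + ητ/2`, it
  -- loses `ητ` and ends at most at `M - ητ/2`.
  refine ⟨min (d / 2) (η * τ / 2), lt_min (by linarith) (by linarith), ?_⟩
  set d' := min (d / 2) (η * τ / 2)
  have hd1 : d' ≤ d / 2 := min_le_left _ _
  have hd2 : d' ≤ η * τ / 2 := min_le_right _ _
  filter_upwards [hM (M + η * τ / 2) (by linarith), eventually_ge_atTop 0] with a haM ha0 hi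
  by_contra! hb
  have hder : ∀ᵐ t, a < t → t < a + τ → M - d' < X (σ i) t →
      ∃ v, HasDerivAt (X (σ i)) v t ∧ v ≤ -η := by
    filter_upwards [h.follows i] with t ht h1 h2 hr
    obtain ⟨v, hv, -, hv2⟩ := ht (ha0.trans_lt h1)
    have := hi t ⟨h1.le, h2.le⟩
    exact ⟨v, hv, (hv2 (-(d / 2)) (by linarith)).trans (by rw [hη, neg_neg])⟩
  have hall : ∀ t, a < t → t < a + τ → M - d' < X (σ i) t := by
    intro s hs1 hs2
    by_contra! hs
    refine absurd ((h.ac (σ i)).le_of_deriv_nonpos_above (ha0.trans hs1.le) hs2.le ?_ hs)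
      (not_le.mpr hb)
    filter_upwards [hder] with t ht h1 h2 hr
    obtain ⟨v, hv, hle⟩ := ht (hs1.trans h1) h2 hr
    exact ⟨v, hv, by linarith⟩
  have := (h.ac (σ i)).le_of_deriv_le (c := -η) ha0 (by linarith : a ≤ a + τ) (by
    filter_upwards [hder] with t ht h1 h2
    exact ht h1 h2 (hall t h1 h2))
  have he : -η * (a + τ - a) = -(η * τ) := by ring
  linarith

/-- If all functions are negative on the negative numbers, then the largest value and the smallest
value have the same limit: no node can stay below the limit `M` of the largest value. -/
theorem eventually_sub_lt [Finite ι] [Nonempty ι] (h : IsCycleSystem σ f X)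
    (hneg : ∀ i, ∀ y < 0, f i y < 0) {M K d₀ : ℝ} (hM : Tendsto (maxVal X) atTop (𝓝 M))
    (hM' : ∀ᶠ t in atTop, M ≤ maxVal X t) (hK : ∀ᶠ t in atTop, ∀ i j, X i t - X j t < K)
    (hd₀ : 0 < d₀) (i₀ : ι) :
    ∀ᶠ t in atTop, M - d₀ < X i₀ t := by
  have hMr : ∀ i, ∀ r > M, ∀ᶠ t in atTop, X i t ≤ r := fun i r hr =>
    (hM.eventually_lt_const hr).mono fun t ht => (le_maxVal X i t).trans ht.le
  obtain ⟨L, hL, hgrow⟩ : ∃ L > 0, ∀ᶠ t in atTop, ∀ s ≥ 0, X i₀ (t + s) ≤ X i₀ t + L * s := by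
    obtain ⟨j, rfl⟩ := h.surjective i₀
    -- Differences stay below `K`, so `f (σ j) K` bounds the velocity from above; the `1` only makes
    -- `L` positive.
    refine ⟨max (f (σ j) K) 1, lt_max_of_lt_right one_pos, ?_⟩
    filter_upwards [eventually_forall_ge_atTop.mpr hK, eventually_ge_atTop 0] with t ht ht0 s hs
    have := (h.ac (σ j)).le_of_deriv_le (c := max (f (σ j) K) 1) ht0
      (by linarith : t ≤ t + s) (by
        filter_upwards [h.follows j] with r hr h1 _
        obtain ⟨v, hv, -, hv2⟩ := hr (ht0.trans_lt h1)
        exact ⟨v, hv, (hv2 K (ht r h1.le j (σ j))).trans (le_max_left _ _)⟩)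
    rwa [add_sub_cancel_left] at this
  set τ := d₀ / (2 * L) with hτdef
  have hτ : 0 < τ := by positivity
  have hLτ : L * τ = d₀ / 2 := by rw [hτdef]; field_simp
  -- The lag `d` may depend on `j` and `ρ` but not on `t`. Passing to a successor uses a window of
  -- length `ρ / 2` for the pull, so the predecessor's bound is needed from `ρ / 2` on; since `ρ` is
  -- arbitrary, every node is reached before time `τ`.
  have hall := h.cycle_induction
    (fun j => ∀ ρ, 0 < ρ → ρ ≤ τ → ∃ d > 0, ∀ᶠ t in atTop, X i₀ t ≤ M - d₀ →
      ∀ s ∈ Icc ρ τ, X j (t + s) ≤ M - d)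
    ⟨i₀, fun ρ hρ _ => ⟨d₀ / 2, by linarith, by
      filter_upwards [hgrow] with t ht hle s hs
      have h1 := ht s (hρ.le.trans hs.1)
      have h2 := mul_le_mul_of_nonneg_left hs.2 hL.le
      linarith⟩⟩
    (by
      intro i hi ρ hρ hρτ
      obtain ⟨d, hd, hev⟩ := hi (ρ / 2) (by linarith) (by linarith)
      obtain ⟨d', hd', hev'⟩ := h.le_sub_of_predecessor_le (hneg (σ i)) hd
        (half_pos hρ) (hMr (σ i))
      refine ⟨d', hd', ?_⟩
      filter_upwards [hev, eventually_forall_ge_atTop.mpr hev'] with t ht ht' hle s hs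
      have := ht' (t + s - ρ / 2) (by linarith [hs.1]) (fun r hr => by
        have := ht hle (r - t) ⟨by linarith [hr.1, hs.1], by linarith [hr.2, hs.2]⟩
        rwa [add_sub_cancel] at this)
      rwa [sub_add_cancel] at this)
  choose d hd hev using fun j => hall j τ hτ le_rfl
  filter_upwards [eventually_all.mpr hev, eventually_forall_ge_atTop.mpr hM'] with t ht htM
  by_contra! hle
  obtain ⟨j, hj⟩ := exists_eq_maxVal X (t + τ)
  linarith [ht j hle τ ⟨le_rfl, le_rfl⟩, htM (t + τ) (by linarith), hd j]

end IsCycleSystem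

/-! ### Convergence of the differences along a cycle -/

theorem exists_tendsto_of_antitoneOn_Ici {F : ℝ → ℝ} {a c : ℝ} (hF : AntitoneOn F (Ici a))
    (hc : ∀ t ≥ a, c ≤ F t) :
    ∃ M, Tendsto F atTop (𝓝 M) ∧ ∀ᶠ t in atTop, M ≤ F t := by
  have hanti : Antitone fun t => F (max t a) := fun s t hst =>
    hF (le_max_right s a) (le_max_right t a) (max_le_max_right a hst)
  have hbdd : BddBelow (range fun t => F (max t a)) :=
    ⟨c, by rintro _ ⟨t, rfl⟩; exact hc _ (le_max_right t a)⟩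
  have heq : (fun t => F (max t a)) =ᶠ[atTop] F :=
    (eventually_ge_atTop a).mono fun t ht => by simp only [max_eq_left ht]
  refine ⟨_, (tendsto_atTop_ciInf hanti hbdd).congr' heq, ?_⟩
  filter_upwards [eventually_ge_atTop a] with t ht
  simpa only [max_eq_left ht] using ciInf_le hbdd t

namespace IsCycleSystem

variable {ι : Type*} {σ : ι → ι} {f : ι → ℝ → ℝ} {X : ι → ℝ → ℝ}

/-- The differences along the edges of a cycle converge, and their limits are zeros of the
functions on the edges, in the sense of Filippov. -/
theorem exists_tendsto_edge [Finite ι] [Nonempty ι] (h : IsCycleSystem σ f X) (i : ι) :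
    ∃ l, Tendsto (fun t => X i t - X (σ i) t) atTop (𝓝 l) ∧
      (∀ y < l, f (σ i) y ≤ 0) ∧ ∀ y > l, 0 ≤ f (σ i) y := by
  have hcons : Tendsto (fun t => X i t - X (σ i) t) atTop (𝓝 0) →
      ∃ l, Tendsto (fun t => X i t - X (σ i) t) atTop (𝓝 l) ∧
        (∀ y < l, f (σ i) y ≤ 0) ∧ ∀ y > l, 0 ≤ f (σ i) y := fun h0 =>
    ⟨0, h0, fun y hy => h.zero (σ i) ▸ h.mono _ hy.le, fun y hy => h.zero (σ i) ▸ h.mono _ hy.le⟩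
  by_cases hex : ∃ a ≥ 0, ∀ i, X i a = maxVal X a
  · obtain ⟨a, ha, heq⟩ := hex
    refine hcons (tendsto_const_nhds.congr' ?_)
    filter_upwards [eventually_ge_atTop a] with t ht
    rw [h.consensus_persists ha ht heq i, h.consensus_persists ha ht heq (σ i), sub_self]
  push Not at hex
  set N : ι → ℝ → ℝ := fun i t => -X i t with hN
  have hXN : ∀ j t, -X j t ≤ maxVal N t := fun j t => le_maxVal N j t
  have hexN : ∀ t ≥ 0, ∃ i, N i t ≠ maxVal N t := by
    intro t ht
    by_contra! hcon
    obtain ⟨i, hi⟩ := hex t ht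
    obtain ⟨j, hj⟩ := exists_eq_maxVal X t
    have h1 := hcon i
    have h2 := hcon j
    simp only [hN] at h1 h2
    exact hi (by linarith)
  have hanti : AntitoneOn (maxVal X) (Ici 0) := fun a ha b _ hab =>
    h.maxVal_le ha hab fun t ht _ => hex t (le_trans ha ht.le)
  have hantiN : AntitoneOn (maxVal N) (Ici 0) := fun a ha b _ hab =>
    h.neg.maxVal_le ha hab fun t ht _ => hexN t (le_trans ha ht.le)
  obtain ⟨M, hM, hM'⟩ := exists_tendsto_of_antitoneOn_Ici (c := -maxVal N 0) hanti fun t ht => by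
    linarith [hXN i t, le_maxVal X i t, hantiN (mem_Ici.mpr le_rfl) ht ht]
  obtain ⟨m, hm, hm'⟩ := exists_tendsto_of_antitoneOn_Ici (c := -maxVal X 0) hantiN fun t ht => by
    linarith [hXN i t, le_maxVal X i t, hanti (mem_Ici.mpr le_rfl) ht ht]
  have hsum : Tendsto (fun t => maxVal X t + maxVal N t) atTop (𝓝 (M + m)) := hM.add hm
  have hdiff : ∀ i j t, X i t - X j t ≤ maxVal X t + maxVal N t := fun i j t => by
    linarith [hXN j t, le_maxVal X i t]
  have hnonneg : 0 ≤ M + m := ge_of_tendsto' hsum fun t => by simpa using hdiff i i t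
  have hle : ∀ i, IsBoundedUnder (· ≤ ·) atTop (X i) := fun i =>
    hM.isBoundedUnder_le.mono_le (Eventually.of_forall fun t => le_maxVal X i t)
  have hge : ∀ i, IsBoundedUnder (· ≥ ·) atTop (X i) := fun i =>
    hm.neg.isBoundedUnder_ge.mono_ge (Eventually.of_forall fun t => neg_le.mp (hXN i t))
  have hgeN : ∀ i, IsBoundedUnder (· ≥ ·) atTop (N i) := fun i =>
    hM.neg.isBoundedUnder_ge.mono_ge
      (Eventually.of_forall fun t => neg_le_neg (le_maxVal X i t))
  rcases hnonneg.eq_or_lt with hzero | hpos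
  -- The limit of the smallest value is `-m`, so `M + m = 0` means asymptotic consensus.
  · rw [← hzero] at hsum
    refine hcons (squeeze_zero_norm (fun t => ?_) hsum)
    rw [Real.norm_eq_abs, abs_le]
    exact ⟨by linarith [hdiff (σ i) i t], hdiff i (σ i) t⟩
  refine h.exists_tendsto_sub hle hge ?_ i
  by_cases hall : ∀ i, ∀ y < 0, f i y < 0
  · exfalso
    -- Taking the lag `M + m` puts every node eventually above `-m`, while the smallest one is at
    -- most `-m`.
    have hK : ∀ᶠ t in atTop, ∀ i j, X i t - X j t < M + m + 1 :=
      (hsum.eventually_lt_const (lt_add_one _)).mono fun t ht i j => (hdiff i j t).trans_lt ht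
    obtain ⟨t, h1, h2⟩ := ((eventually_all.mpr
      fun i => h.eventually_sub_lt hall hM hM' hK hpos i).and hm').exists
    obtain ⟨j, hj⟩ := exists_eq_maxVal N t
    have := h1 j
    simp only [hN] at hj h2
    linarith
  · push Not at hall
    obtain ⟨i₀, y₀, hy₀, hf⟩ := hall
    obtain ⟨j, l, hl⟩ := h.neg.exists_tendsto_of_nonpos hgeN hm hm' (i₀ := i₀) (y₀ := -y₀)
      (by linarith) (by simpa using hf)
    exact ⟨j, -l, by simpa using hl.neg⟩

end IsCycleSystem

/-! ### Filippov maps and the distance to a preimage -/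

/-- A null set cannot cover either side of `l`, so values of both signs survive and their convex
hull contains `0`. -/
theorem zero_mem_filippovMap {g : ℝ → ℝ} {l : ℝ} (hneg : ∀ y < l, g y ≤ 0)
    (hpos : ∀ y > l, 0 ≤ g y) : (0 : ℝ) ∈ filippovMap g l := by
  simp only [filippovMap, mem_iInter]
  intro δ hδ S hS
  have hex : ∀ a b : ℝ, a < b → ∃ y ∈ Ioo a b, y ∉ S := by
    intro a b hab
    by_contra! hcon
    have := measure_mono_null (show Ioo a b ⊆ S from hcon) hS
    rw [Real.volume_Ioo, ENNReal.ofReal_eq_zero] at this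
    linarith
  obtain ⟨y₁, hy₁, hS₁⟩ := hex (l - δ) l (by linarith)
  obtain ⟨y₂, hy₂, hS₂⟩ := hex l (l + δ) (by linarith)
  have hmem : ∀ y, l - δ < y → y < l + δ → y ∉ S →
      g y ∈ convexHull ℝ (g '' (Metric.ball l δ \ S)) := fun y h1 h2 h3 =>
    subset_convexHull ℝ _ ⟨y, ⟨by rw [Real.ball_eq_Ioo]; exact ⟨h1, h2⟩, h3⟩, rfl⟩
  exact subset_closure ((convex_convexHull ℝ _).ordConnected.out
    (hmem y₁ hy₁.1 (by linarith [hy₁.2]) hS₁) (hmem y₂ (by linarith [hy₂.1]) hy₂.2 hS₂)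
    ⟨hneg y₁ hy₁.2, hpos y₂ hy₂.1⟩)

/-- A continuous linear functional which is at most `c` on the values of `X` near `x` is at most
`c` on the Filippov set-valued map. -/
theorem map_le_of_mem_filippovMap {E F : Type*} [NormedAddCommGroup E] [MeasureSpace E]
    [NormedAddCommGroup F] [NormedSpace ℝ F] {X : E → F} {x : E} {v : F}
    (hv : v ∈ filippovMap X x) (φ : F →L[ℝ] ℝ) {c : ℝ} (h : ∀ᶠ z in 𝓝 x, φ (X z) ≤ c) :
    φ v ≤ c := by
  obtain ⟨δ, hδ, hball⟩ := Metric.eventually_nhds_iff_ball.mp h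
  simp only [filippovMap, mem_iInter] at hv
  have hsub : closure (convexHull ℝ (X '' (Metric.ball x δ \ ∅))) ⊆ {w | φ w ≤ c} := by
    refine closure_minimal (convexHull_min ?_ (convex_halfSpace_le φ.isLinear c))
      (isClosed_le φ.continuous continuous_const)
    rintro _ ⟨z, hz, rfl⟩
    exact hball z hz.1
  exact hsub (hv δ hδ ∅ measure_empty)

/-- If `D x(t)` converges to a point of `S`, with `D` linear between finite-dimensional spaces,
then `x(t)` converges to the set `D ⁻¹' S`. -/
theorem tendsto_infDist_preimage {α V W : Type*} {u : Filter α} [NormedAddCommGroup V]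
    [NormedSpace ℝ V] [NormedAddCommGroup W] [NormedSpace ℝ W] [FiniteDimensional ℝ W]
    (D : V →ₗ[ℝ] W) {S : Set W} {x : α → V} {l : W} (hl : l ∈ S)
    (h : Tendsto (fun t => D (x t)) u (𝓝 l)) :
    Tendsto (fun t => Metric.infDist (x t) (D ⁻¹' S)) u (𝓝 0) := by
  rcases u.eq_or_neBot with rfl | hu
  · exact tendsto_bot
  have hrange : l ∈ LinearMap.range D :=
    (Submodule.closed_of_finiteDimensional (LinearMap.range D)).mem_of_tendsto h
      (Eventually.of_forall fun t => LinearMap.mem_range_self D (x t))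
  obtain ⟨R, hR⟩ := D.rangeRestrict.exists_rightInverse_of_surjective D.range_rangeRestrict
  have hR' : ∀ w, D (R w) = w := fun w => congrArg Subtype.val (LinearMap.congr_fun hR w)
  -- The defect `l - D (x t)` is corrected by a linear right inverse of `D` on its range, at a cost
  -- tending to `0`; `x` itself need not converge.
  set r : α → LinearMap.range D := fun t => ⟨l, hrange⟩ - D.rangeRestrict (x t) with hr
  have hq : Tendsto (fun t => D.rangeRestrict (x t)) u (𝓝 ⟨l, hrange⟩) := by
    rw [tendsto_subtype_rng]
    exact h
  have hr0 : Tendsto r u (𝓝 0) := by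
    simpa using (tendsto_const_nhds (x := (⟨l, hrange⟩ : LinearMap.range D))).sub hq
  have hRr : Tendsto (fun t => ‖R (r t)‖) u (𝓝 0) := by
    have := ((LinearMap.continuous_of_finiteDimensional R).tendsto 0).comp hr0
    simpa using this.norm
  refine squeeze_zero (fun t => Metric.infDist_nonneg) (fun t => ?_) hRr
  have hmem : x t + R (r t) ∈ D ⁻¹' S := by
    rw [mem_preimage, map_add, hR']
    simpa [hr] using hl
  simpa using Metric.infDist_le_dist_of_mem hmem (x := x t)

/-! ### From the directed ring to a cycle of followers -/

namespace WeightedDigraph.IsRingLabelling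

variable {n : ℕ} {G : WeightedDigraph n} {e : Fin n → Fin n × Fin n}

theorem tail_ne (he : G.IsRingLabelling e) (i : Fin n) : (e i).1 ≠ (e i).2 := by
  intro h
  have := (he i).2
  rw [h, Edge, G.diag] at this
  exact lt_irrefl _ this

theorem edgeDiff_eq_sub (he : G.IsRingLabelling e) (x : EuclideanSpace ℝ (Fin n)) (i : Fin n) :
    edgeDiff e x i = x (e i).1 - x i := by
  rw [edgeDiff_eq e x i (he.tail_ne i), (he i).1]

theorem tail_injective (he : G.IsRingLabelling e) (hG : G.IsDirectedRing) :
    Function.Injective fun i => (e i).1 := by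
  intro i j hij
  have hi := (he i).2
  have hj := (he j).2
  rw [(he i).1] at hi
  rw [(he j).1, ← show (e i).1 = (e j).1 from hij] at hj
  exact (hG.1 _).unique hi hj

/-- Each coordinate of a Filippov solution follows its predecessor on the ring. -/
theorem follows (he : G.IsRingLabelling e) {g : Fin n → ℝ → ℝ} (hg : ∀ i, Monotone (g i))
    {x : ℝ → EuclideanSpace ℝ (Fin n)} (hx : IsFilippovSolution (ringField G e g) x)
    (i : Fin n) :
    Follows (fun y => G.weight (e i) * g i y) (fun t => x t (e i).1) (fun t => x t i) := by
  have hw : 0 ≤ G.weight (e i) := G.nonneg _ _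
  have hcont : Continuous fun z : EuclideanSpace ℝ (Fin n) => edgeDiff e z i := by
    simp only [he.edgeDiff_eq_sub]
    fun_prop
  filter_upwards [(ae_restrict_iff' measurableSet_Ioi).mp hx.2] with t ht ht0
  obtain ⟨v, hv, hd⟩ := ht ht0
  refine ⟨v i,
    (EuclideanSpace.proj (𝕜 := ℝ) i).hasFDerivAt.comp_hasDerivAt t hd, fun y hy => ?_, fun y hy => ?_⟩
  · rw [← he.edgeDiff_eq_sub] at hy
    refine neg_le_neg_iff.mp
      (map_le_of_mem_filippovMap hv (-(EuclideanSpace.proj (𝕜 := ℝ) i)) ?_)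
    filter_upwards [hcont.continuousAt.eventually_const_lt hy] with z hz
    exact neg_le_neg (mul_le_mul_of_nonneg_left (hg i hz.le) hw)
  · rw [← he.edgeDiff_eq_sub] at hy
    refine map_le_of_mem_filippovMap hv (EuclideanSpace.proj (𝕜 := ℝ) i) ?_
    filter_upwards [hcont.continuousAt.eventually_lt_const hy] with z hz
    exact mul_le_mul_of_nonneg_left (hg i hz.le) hw

theorem exists_tendsto_edgeDiff (he : G.IsRingLabelling e) (hG : G.IsDirectedRing)
    {g : Fin n → ℝ → ℝ} (hg : ∀ i, Monotone (g i)) (hg0 : ∀ i, g i 0 = 0)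
    {x : ℝ → EuclideanSpace ℝ (Fin n)} (hx : IsFilippovSolution (ringField G e g) x)
    (i : Fin n) :
    ∃ l, Tendsto (fun t => edgeDiff e (x t) i) atTop (𝓝 l) ∧ (0 : ℝ) ∈ filippovMap (g i) l := by
  set π : Equiv.Perm (Fin n) := Equiv.ofBijective _
    (Finite.injective_iff_bijective.mp (he.tail_injective hG))
  have hπ : ∀ j, (e (π⁻¹ j)).1 = j := fun j => π.apply_symm_apply j
  have hw : ∀ j, 0 < G.weight (e j) := fun j => (he j).2
  -- One incoming and one outgoing edge per node still allows several disjoint cycles, so only the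
  -- cycle through the edge towards `i` is kept.
  set ι := {j : Fin n // π⁻¹.SameCycle (π i) j}
  set s : ι → ι := fun j => ⟨π⁻¹ j.1, Equiv.Perm.sameCycle_apply_right.mpr j.2⟩ with hs
  have hsys : IsCycleSystem s (fun j y => G.weight (e j.1) * g j.1 y) (fun j t => x t j.1) :=
    { mono := fun j a b hab => mul_le_mul_of_nonneg_left (hg _ hab) (hw _).le
      zero := fun j => by simp [hg0]
      ac := fun j => LocallyAbsolutelyContinuous.of_dist_le_sum (X := fun _ : Unit => x)
        (fun _ => hx.1) fun a b => by
          simpa [Real.dist_eq, dist_eq_norm] using PiLp.norm_apply_le (x a - x b) j.1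
      follows := fun j => by
        have := he.follows hg hx (π⁻¹ j.1)
        rwa [hπ] at this
      cycle_induction := by
        rintro P ⟨a, ha⟩ hP b
        have hk : ∀ k : ℕ, P (s^[k] a) := fun k => by
          induction k with
          | zero => exact ha
          | succ k ih => rw [Function.iterate_succ_apply']; exact hP _ ih
        have hval : ∀ k : ℕ, (s^[k] a).1 = (π⁻¹ ^ k) a.1 := fun k => by
          induction k with
          | zero => rfl
          | succ k ih =>
            rw [Function.iterate_succ_apply', pow_succ', Equiv.Perm.mul_apply, ← ih]
        obtain ⟨k, -, -, hkb⟩ := (a.2.symm.trans b.2).exists_pow_eq''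
        have : s^[k] a = b := Subtype.ext ((hval k).trans hkb)
        exact this ▸ hk k }
  have hne : Nonempty ι := ⟨⟨π i, Equiv.Perm.SameCycle.refl _ _⟩⟩
  obtain ⟨l, hl, h1, h2⟩ := hsys.exists_tendsto_edge ⟨π i, Equiv.Perm.SameCycle.refl _ _⟩
  have hsi : π⁻¹ (π i) = i := π.symm_apply_apply i
  simp only [hs, hsi] at hl h1 h2
  refine ⟨l, ?_, zero_mem_filippovMap (fun y hy => ?_) (fun y hy => ?_)⟩
  · simp only [he.edgeDiff_eq_sub]
    exact hl
  · exact nonpos_of_mul_nonpos_right (h1 y hy) (hw i)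
  · exact nonneg_of_mul_nonneg_right (h2 y hy) (hw i)

end WeightedDigraph.IsRingLabelling

theorem mainTheorem4 (n : ℕ) (G : WeightedDigraph n) (hG : G.IsDirectedRing)
    (e : Fin n → Fin n × Fin n) (he : G.IsRingLabelling e)
    (g : Fin n → ℝ → ℝ) (hg : ∀ i, IsAdmissible (g i))
    (hcase : (n = 2 ∧ ∀ i, Function.Odd (g i)) ∨
      (3 ≤ n ∧ (∀ i, g i 0 = 0) ∧ ∃ i, filippovMap (g i) 0 = {0}))
    (x : ℝ → EuclideanSpace ℝ (Fin n)) (hx : IsFilippovSolution (ringField G e g) x) :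
    Filter.Tendsto (fun t => Metric.infDist (x t) (ringLimitSet e g)) Filter.atTop (nhds 0) := by
  have hg0 : ∀ i, g i 0 = 0 := by
    rcases hcase with ⟨-, hodd⟩ | ⟨-, h0, -⟩
    · exact fun i => (hodd i).map_zero
    · exact h0
  choose l hl hmem using fun i => he.exists_tendsto_edgeDiff hG (fun i => (hg i).1) hg0 hx i
  exact tendsto_infDist_preimage
    ((incidence e).transpose.mulVecLin ∘ₗ (WithLp.linearEquiv 2 ℝ (Fin n → ℝ)).toLinearMap)
    (S := {y | (0 : Fin n → ℝ) ∈ Set.univ.pi fun i => filippovMap (g i) (y i)}) (l := l)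
    (fun i _ => hmem i) (tendsto_pi_nhds.mpr hl)
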